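/- Fix a countably infinite set of message tags. A session type is a possibly infinite tree $S, T ::= \mathsf{end} \mid \sum_{i\in I} {?}a_i.S_i \mid \sum_{i\in I} {!}a_i.S_i$, where each index set $I$ is finite and non-empty, the tags $a_i$ of a choice are pairwise distinct, and every subtree contains a leaf $\mathsf{end}$. A session type is regular if it has finitely many distinct subtrees; regular session types are finitely presented as solutions of finite systems of equations $X_i = \mathsf{end}$ or $X_i = \sum_k p\,a_k.X_{j_k}$ with $p\in\{?,!\}$. A configuration $[S,\omega_S]\,|\,[T,\omega_T]$ consists of two partners, each with a FIFO queue of incoming messages. If a partner is a choice $\sum_{i\in I}{!}a_i.S_i$ it may, for any $i \in I$, append $a_i$ to the queue of the other partner and become $S_i$; if it is a choice $\sum_{i\in I}{?}a_i.S_i$ and the first message of its own queue is $a_i$, it may remove that message and become $S_i$. A configuration $C$ is correct if $C \to^* C'$ implies $C' \to^* [\mathsf{end},\varepsilon]\,|\,[\mathsf{end},\varepsilon]$. Session types $R$ and $S$ are compliant if $[R,\varepsilon]\,|\,[S,\varepsilon]$ is correct. Fair asynchronous subtyping $S \preceq T$ holds if every session type $R$ that is compliant with $T$ is also compliant with $S$.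 Theorem. The problem of checking, given finite presentations of two session types $S$ and $T$, whether $S \preceq T$ is undecidable: no computable function decides it on all pairs of systems of equations that present session types. The same holds if, in the definition of $\preceq$, $R$ ranges over regular session types only. -/

import Mathlib

namespace FairAsync

/-- Message tags: a fixed countably infinite set. -/
abbrev Tag : Type := ℕ

/-- `input` is written `?` and `output` is written `!`. -/
inductive Polarity : Type
  | input
  | output

/-- Polarities as truth values, used only to encode them. -/
def Polarity.equivBool : Polarity ≃ Bool where
  toFun p := match p with
    | .input => false
    | .output => true
  invFun b := match b with
    | false => .input
    | true => .output
  left_inv p := by cases p <;> rfl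
  right_inv b := by cases b <;> rfl

instance : Primcodable Polarity := Primcodable.ofEquiv Bool Polarity.equivBool

/-- The signature of session trees. A node is either `end` (`none`), without children, or a choice
`∑_{i ∈ I} p a_i.S_i` where `p` is a polarity and `{a_i | i ∈ I}` is a finite non-empty set of
tags, with one child for each tag. -/
def sig : PFunctor.{0, 0} where
  A := Option (Polarity × {I : Finset Tag // I.Nonempty})
  B a := match a with
    | none => Empty
    | some (_, I) => {a : Tag // a ∈ I.1}

/-- The possibly infinite trees over the signature (its final coalgebra). -/
abbrev Tree : Type := sig.M

/-- The tree `end`. -/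
noncomputable def Tree.done : Tree := PFunctor.M.mk ⟨none, fun x => Empty.elim x⟩

/-- The choice `∑_{a ∈ I} p a.(k a)`. -/
noncomputable def Tree.choice (p : Polarity) (I : {I : Finset Tag // I.Nonempty})
    (k : {a : Tag // a ∈ I.1} → Tree) : Tree :=
  PFunctor.M.mk ⟨some (p, I), k⟩

/-- `Step S p a S'`: `S` is a choice of polarity `p` that has a branch tagged `a` whose
continuation is `S'`. -/
inductive Step : Tree → Polarity → Tag → Tree → Prop
  | mk (p : Polarity) (I : {I : Finset Tag // I.Nonempty}) (k : {a : Tag // a ∈ I.1} → Tree)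
      (a : {a : Tag // a ∈ I.1}) : Step (Tree.choice p I k) p a.1 (k a)

/-- `Subtree S T`: `T` is a subtree of `S` (possibly `S` itself). -/
def Subtree : Tree → Tree → Prop :=
  Relation.ReflTransGen fun S S' => ∃ p a, Step S p a S'

/-- A tree is well formed if each of its subtrees contains a leaf `end`. -/
def WellFormed (S : Tree) : Prop :=
  ∀ S', Subtree S S' → Subtree S' Tree.done

/-- Session types. -/
def SessionType : Type := {S : Tree // WellFormed S}

/-- A session type is regular if it has finitely many distinct subtrees. -/
def SessionType.Regular (S : SessionType) : Prop :=
  {S' : Tree | Subtree S.1 S'}.Finite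

/-! Buffer-based asynchronous semantics -/

/-- A configuration `[S, ω_S] | [T, ω_T]` of two partners, each with the FIFO queue of the messages
that it has been sent and has not consumed yet. -/
structure Config : Type where
  left : Tree
  leftQueue : List Tag
  right : Tree
  rightQueue : List Tag

/-- Reduction of configurations: an output appends a message to the queue of the partner, an input
consumes the first message of one's own queue. -/
inductive Red : Config → Config → Prop
  | leftOutput {S S' T : Tree} {u v : List Tag} {a : Tag} (h : Step S .output a S') :
      Red ⟨S, u, T, v⟩ ⟨S', u, T, v ++ [a]⟩
  | leftInput {S S' T : Tree} {u v : List Tag} {a : Tag} (h : Step S .input a S') :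
      Red ⟨S, a :: u, T, v⟩ ⟨S', u, T, v⟩
  | rightOutput {S T T' : Tree} {u v : List Tag} {a : Tag} (h : Step T .output a T') :
      Red ⟨S, u, T, v⟩ ⟨S, u ++ [a], T', v⟩
  | rightInput {S T T' : Tree} {u v : List Tag} {a : Tag} (h : Step T .input a T') :
      Red ⟨S, u, T, a :: v⟩ ⟨S, u, T', v⟩

/-- A configuration is correct if, whatever reductions it performs, it can still terminate
successfully: both partners are `end` and both queues are empty. -/
def Config.Correct (C : Config) : Prop :=
  ∀ C', Relation.ReflTransGen Red C C' →
    Relation.ReflTransGen Red C' ⟨Tree.done, [], Tree.done, []⟩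

/-- Two session types are compliant if their composition with empty queues is correct. -/
def Compliant (R S : SessionType) : Prop :=
  Config.Correct ⟨R.1, [], S.1, []⟩

/-- Fair asynchronous subtyping (refinement) `S ≼ T`: every session type that is compliant with `T`
is compliant with `S`. -/
def Refines (S T : SessionType) : Prop :=
  ∀ R : SessionType, Compliant R T → Compliant R S

/-- The variant of `S ≼ T` in which only regular session types are used as tests. -/
def RegularRefines (S T : SessionType) : Prop :=
  ∀ R : SessionType, R.Regular → Compliant R T → Compliant R S

/-! Finite presentations of session types -/

/-- The right-hand side of an equation: `none` stands for `end` and `some (p, [(a₁, j₁), …])` for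
`∑ p a_i.X_{j_i}`. -/
abbrev Rhs : Type := Option (Polarity × List (Tag × ℕ))

/-- A finite system of equations `X_i = rhs_i`, given by the list of its right-hand sides. -/
abbrev System : Type := List Rhs

/-- `Solves sys sol`: the session types `sol i` satisfy all equations of `sys`, whose choices are
non-empty, have pairwise distinct tags and mention only unknowns of the system. -/
def Solves (sys : System) (sol : ℕ → SessionType) : Prop :=
  ∀ (i : ℕ) (hi : i < sys.length),
    match sys[i] with
    | none => (sol i).1 = Tree.done
    | some (p, branches) =>
        branches ≠ [] ∧ (branches.map Prod.fst).Nodup ∧ (∀ b ∈ branches, b.2 < sys.length) ∧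
        ∀ (q : Polarity) (a : Tag) (S : Tree),
          Step (sol i).1 q a S ↔ q = p ∧ ∃ j, (a, j) ∈ branches ∧ S = (sol j).1

/-- `Presents sys S`: `S` is the first component of the solution of `sys`. -/
def Presents (sys : System) (S : SessionType) : Prop :=
  sys ≠ [] ∧ ∃ sol : ℕ → SessionType, Solves sys sol ∧ sol 0 = S

/-- The algorithm `f` decides the relation `rel` between session types given by finite systems of
equations. -/
def Decides (f : System × System → Bool) (rel : SessionType → SessionType → Prop) : Prop :=
  ∀ (P Q : System) (S T : SessionType), Presents P S → Presents Q T →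
    (f (P, Q) = true ↔ rel S T)

end FairAsync

namespace FairAsync

open Relation

/-! The supertype is fixed: `T = ∑ₓ !x.?x.T + !0.end`. At each round `T` may choose `0` and become
`end`, so a compliant partner can never send ahead of time. After receiving `x` it must send back
exactly `x` and be compliant with `T` again, and on `0` it must become `end` (`Echo.step_zero`,
`Echo.step_hold`). Every compliant partner therefore acts as an unbounded queue that returns symbols
in order.

The subtype is the driver of a queue machine: it reads a symbol, sends the word prescribed by the
transition function, and on halting sends `0`. Against any echoing partner, the symbols in transit
form the queue of the machine, so the composition is correct iff the machine halts with empty queue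
(`correct_driver_iff`). This condition does not mention the partner, and a regular echoing partner
exists (`compliant_echoType`), so both forms of refinement are equivalent to halting
(`refines_driver_iff`, `regularRefines_driver_iff`).

Queue machines are universal: one queue holds all stacks of a stack machine, interleaved, and is
rotated to reach the top of a stack (`exists_reaches_stepAux`). A fixed stack machine for a partial
recursive function with undecidable domain is simulated. Its input only determines a prefix of
outputs put before a fixed driver, so the map from inputs to presentations is computable
(`presents_consSystem`). -/

/-! ### Trees unfolded from coalgebras -/

theorem step_choice_iff {p q : Polarity} {I : {I : Finset Tag // I.Nonempty}}
    {k : {a : Tag // a ∈ I.1} → Tree} {a : Tag} {S : Tree} :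
    Step (Tree.choice p I k) q a S ↔ q = p ∧ ∃ h : a ∈ I.1, S = k ⟨a, h⟩ := by
  constructor
  · intro h
    generalize hT : Tree.choice p I k = T at h
    cases h with
    | mk p' I' k' a' =>
      have h2 := PFunctor.M.mk_inj hT
      cases h2
      exact ⟨rfl, a'.2, rfl⟩
  · rintro ⟨rfl, h, rfl⟩
    exact Step.mk q I k ⟨a, h⟩

theorem not_step_done {p : Polarity} {a : Tag} {S : Tree} : ¬ Step Tree.done p a S := by
  intro h
  generalize hT : Tree.done = T at h
  cases h with
  | mk p' I' k' a' =>
    have h2 := congrArg Sigma.fst (PFunctor.M.mk_inj hT)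
    cases h2

theorem Step.deterministic {S S₁ S₂ : Tree} {p q : Polarity} {a : Tag}
    (h₁ : Step S p a S₁) (h₂ : Step S q a S₂) : S₁ = S₂ := by
  cases h₁ with
  | mk _ I k b =>
    obtain ⟨-, _, rfl⟩ := step_choice_iff.1 h₂
    rfl

theorem Step.polarity_unique {S S₁ S₂ : Tree} {p q : Polarity} {a b : Tag}
    (h₁ : Step S p a S₁) (h₂ : Step S q b S₂) : p = q := by
  cases h₁ with
  | mk _ I k b => exact (step_choice_iff.1 h₂).1.symm

/-- `Branch x p a r`: the node `x` is a choice of polarity `p` with a branch tagged `a` that leads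
to the state `r`. -/
def Branch {Q : Type} : sig Q → Polarity → Tag → Q → Prop
  | ⟨none, _⟩, _, _, _ => False
  | ⟨some (p, I), k⟩, q, a, r => q = p ∧ ∃ h : a ∈ I.1, r = k ⟨a, h⟩

/-- The tree unfolded from a state of a coalgebra. -/
noncomputable def unfold {Q : Type} (f : Q → sig Q) (q : Q) : Tree := PFunctor.M.corec f q

theorem unfold_eq_done {Q : Type} {f : Q → sig Q} {q : Q} (h : (f q).1 = none) :
    unfold f q = Tree.done := by
  rw [unfold, PFunctor.M.corec_def]
  generalize f q = x at h
  obtain ⟨a, k⟩ := x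
  cases h
  unfold Tree.done
  congr 1
  refine Sigma.ext rfl (heq_of_eq ?_)
  funext x
  exact x.elim

theorem step_unfold_iff {Q : Type} {f : Q → sig Q} {q : Q} {p : Polarity} {a : Tag} {S : Tree} :
    Step (unfold f q) p a S ↔ ∃ r, Branch (f q) p a r ∧ S = unfold f r := by
  rcases hx : f q with ⟨_ | ⟨p', I⟩, k⟩
  · rw [unfold_eq_done (by rw [hx])]
    simp [Branch, not_step_done]
  · have : unfold f q = Tree.choice p' I fun b => unfold f (k b) := by
      rw [unfold, PFunctor.M.corec_def, hx]
      rfl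
    rw [this, step_choice_iff]
    simp only [Branch]
    constructor
    · rintro ⟨rfl, h, rfl⟩
      exact ⟨_, ⟨rfl, h, rfl⟩, rfl⟩
    · rintro ⟨_, ⟨rfl, h, rfl⟩, rfl⟩
      exact ⟨rfl, h, rfl⟩

theorem subtree_unfold {Q : Type} {f : Q → sig Q} {q : Q} {S : Tree}
    (h : Subtree (unfold f q) S) : ∃ r, S = unfold f r := by
  induction h with
  | refl => exact ⟨q, rfl⟩
  | tail _ hs ih =>
    obtain ⟨r, rfl⟩ := ih
    obtain ⟨p, a, hs⟩ := hs
    obtain ⟨r', _, rfl⟩ := step_unfold_iff.1 hs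
    exact ⟨r', rfl⟩

theorem wellFormed_unfold {Q : Type} {f : Q → sig Q} (h : ∀ q, Subtree (unfold f q) Tree.done)
    (q : Q) : WellFormed (unfold f q) := by
  intro S hS
  obtain ⟨r, rfl⟩ := subtree_unfold hS
  exact h r

theorem regular_unfold {Q : Type} [Finite Q] {f : Q → sig Q} {q : Q}
    (h : WellFormed (unfold f q)) : SessionType.Regular ⟨unfold f q, h⟩ := by
  refine (Set.finite_range (unfold f)).subset ?_
  intro S hS
  obtain ⟨r, rfl⟩ := subtree_unfold hS
  exact ⟨r, rfl⟩

/-! ### Finite systems of equations -/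

open Classical in
/-- The branches of an equation whose unknowns are positions in a list of states. -/
noncomputable def branchList {Q : Type} (L : List Q) (I : Finset Tag) (k : {a : Tag // a ∈ I} → Q) :
    List (Tag × ℕ) :=
  I.attach.toList.map fun a => (a.1, L.idxOf (k a))

open Classical in
theorem mem_branchList {Q : Type} {L : List Q} {I : Finset Tag} {k : {a : Tag // a ∈ I} → Q}
    {a : Tag} {j : ℕ} : (a, j) ∈ branchList L I k ↔ ∃ h : a ∈ I, j = L.idxOf (k ⟨a, h⟩) := by
  simp only [branchList, List.mem_map, Finset.mem_toList, Finset.mem_attach, true_and]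
  constructor
  · rintro ⟨⟨a, ha⟩, h⟩
    cases h
    exact ⟨ha, rfl⟩
  · rintro ⟨h, h2⟩
    exact ⟨⟨a, h⟩, Prod.ext rfl h2.symm⟩

theorem nodup_branchList {Q : Type} (L : List Q) (I : Finset Tag) (k : {a : Tag // a ∈ I} → Q) :
    ((branchList L I k).map Prod.fst).Nodup := by
  rw [branchList, List.map_map]
  exact (Finset.nodup_toList _).map Subtype.val_injective

/-- The equation for a node whose successors are looked up in a list of states. -/
noncomputable def nodeRhs {Q : Type} (L : List Q) : sig Q → Rhs
  | ⟨none, _⟩ => none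
  | ⟨some (p, I), k⟩ => some (p, branchList L I.1 k)

/-- The equations are indexed by a finite set closed under branches, because the coalgebra itself
may have infinitely many states, as that of a driver does. -/
theorem exists_presents {Q : Type} (f : Q → sig Q) (hf : ∀ q, WellFormed (unfold f q))
    (X : Set Q) (hX : X.Finite) (hclosed : ∀ q ∈ X, ∀ p a r, Branch (f q) p a r → r ∈ X)
    (q₀ : Q) (hq₀ : q₀ ∈ X) : ∃ sys, Presents sys ⟨unfold f q₀, hf q₀⟩ := by
  classical
  obtain ⟨L, hL, hL0⟩ : ∃ L : List Q, (∀ q, q ∈ L ↔ q ∈ X) ∧ ∃ L', L = q₀ :: L' := by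
    -- A presentation designates unknown `0`, so `q₀` comes first. Its second occurrence is
    -- harmless, since `idxOf` finds the first one.
    refine ⟨q₀ :: hX.toFinset.toList, fun q => ?_, _, rfl⟩
    simp only [List.mem_cons, Finset.mem_toList, Set.Finite.mem_toFinset]
    exact ⟨fun h => h.elim (fun h => h ▸ hq₀) id, Or.inr⟩
  have hget : ∀ q ∈ L, L.getD (L.idxOf q) q₀ = q := by
    intro q hq
    have := List.idxOf_lt_length_of_mem hq
    rw [List.getD_eq_getElem _ _ this]
    exact List.getElem_idxOf this
  refine ⟨L.map fun q => nodeRhs L (f q), ?_, fun i => ⟨unfold f (L.getD i q₀), hf _⟩, ?_, ?_⟩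
  · obtain ⟨L', rfl⟩ := hL0
    simp
  · intro i hi
    rw [List.length_map] at hi
    have hmem : L[i] ∈ X := (hL _).1 (List.getElem_mem hi)
    simp only [List.getElem_map, List.getD_eq_getElem _ _ hi]
    generalize L[i] = q at hmem
    have hcl := hclosed q hmem
    have hst := fun p a S => @step_unfold_iff Q f q p a S
    have hdone := @unfold_eq_done Q f q
    generalize f q = x at hcl hst hdone
    obtain ⟨_ | ⟨p, I⟩, k⟩ := x
    · exact hdone rfl
    · simp only [nodeRhs]
      refine ⟨?_, ?_, ?_, ?_⟩
      · obtain ⟨a, ha⟩ := I.2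
        exact List.ne_nil_of_mem (mem_branchList.2 ⟨ha, rfl⟩)
      · exact nodup_branchList _ _ _
      · rintro ⟨b, j⟩ hb
        obtain ⟨h, rfl⟩ := mem_branchList.1 hb
        rw [List.length_map]
        exact List.idxOf_lt_length_of_mem ((hL _).2 (hcl p b _ ⟨rfl, h, rfl⟩))
      · intro q' a S
        rw [hst]
        constructor
        · rintro ⟨r, ⟨rfl, h, rfl⟩, rfl⟩
          refine ⟨rfl, _, mem_branchList.2 ⟨h, rfl⟩, ?_⟩
          exact congrArg (unfold f) (hget _ ((hL _).2 (hcl _ _ _ ⟨rfl, h, rfl⟩))).symm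
        · rintro ⟨rfl, j, hj, rfl⟩
          obtain ⟨h, rfl⟩ := mem_branchList.1 hj
          refine ⟨k ⟨a, h⟩, ⟨rfl, h, rfl⟩, ?_⟩
          exact congrArg (unfold f) (hget _ ((hL _).2 (hcl _ _ _ ⟨rfl, h, rfl⟩)))
  · obtain ⟨L', rfl⟩ := hL0
    rfl

/-- Renumbering of the unknowns by one. -/
def shiftRhs : Rhs → Rhs :=
  Option.map fun r => (r.1, r.2.map fun b => (b.1, b.2 + 1))

/-- The system that first sends `a` and then behaves as `sys`. -/
def consSystem (a : Tag) (sys : System) : System :=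
  some (.output, [(a, 1)]) :: sys.map shiftRhs

/-- This is how the input of a machine enters a presentation: the new equation becomes unknown `0`
and all others are shifted. -/
theorem presents_consSystem {sys : System} {S S' : SessionType} {a : Tag} (h : Presents sys S)
    (hS' : ∀ q b U, Step S'.1 q b U ↔ q = .output ∧ b = a ∧ U = S.1) :
    Presents (consSystem a sys) S' := by
  obtain ⟨hne, sol, hsol, rfl⟩ := h
  refine ⟨by simp [consSystem], fun i => match i with | 0 => S' | i + 1 => sol i, ?_, rfl⟩
  have hlen : (consSystem a sys).length = sys.length + 1 := by simp [consSystem]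
  rintro (_ | i) hi
  · show _ ∧ _ ∧ _ ∧ _
    refine ⟨by simp, by simp, ?_, ?_⟩
    · simp only [List.mem_singleton, hlen]
      rintro b rfl
      simpa using List.length_pos_iff.2 hne
    · intro q b U
      rw [hS']
      simp only [List.mem_singleton, Prod.mk.injEq]
      constructor
      · rintro ⟨rfl, rfl, rfl⟩
        exact ⟨rfl, 1, ⟨rfl, rfl⟩, rfl⟩
      · rintro ⟨rfl, j, ⟨rfl, rfl⟩, rfl⟩
        exact ⟨rfl, rfl, rfl⟩
  · have hi' : i < sys.length := by omega
    have := hsol i hi'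
    have hget : (consSystem a sys)[i + 1] = shiftRhs sys[i] := by simp [consSystem]
    rw [hget]
    generalize sys[i] = x at this
    rcases x with _ | ⟨p, br⟩
    · exact this
    · obtain ⟨h1, h2, h3, h4⟩ := this
      show _ ∧ _ ∧ _ ∧ _
      refine ⟨by simpa using h1, ?_, ?_, ?_⟩
      · rw [List.map_map]
        exact h2
      · intro b hb
        obtain ⟨c, hc, rfl⟩ := List.mem_map.1 hb
        rw [hlen]
        exact Nat.succ_lt_succ (h3 c hc)
      · intro q b U
        refine (h4 q b U).trans (and_congr_right fun _ => ?_)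
        constructor
        · rintro ⟨j, hj, rfl⟩
          exact ⟨j + 1, List.mem_map.2 ⟨_, hj, rfl⟩, rfl⟩
        · rintro ⟨j, hj, rfl⟩
          obtain ⟨c, hc, h⟩ := List.mem_map.1 hj
          cases h
          exact ⟨c.2, hc, rfl⟩

/-! ### Coalgebras with few kinds of nodes -/

section Nodes

variable {Γ Q : Type} [Fintype Γ]

/-- The tag of a symbol of a finite alphabet; the tag `0` is kept for termination. -/
noncomputable def tag (x : Γ) : Tag := (Fintype.equivFin Γ x : ℕ) + 1

theorem tag_injective : Function.Injective (tag : Γ → Tag) := by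
  intro x y h
  have h' : (Fintype.equivFin Γ x : ℕ) = Fintype.equivFin Γ y := Nat.succ_injective h
  exact (Fintype.equivFin Γ).injective (Fin.ext h')

theorem tag_ne_zero (x : Γ) : tag x ≠ 0 := Nat.succ_ne_zero _

/-- The node of `end`. -/
def leafNode : sig Q := ⟨none, fun x => Empty.elim x⟩

/-- A choice with a single branch. -/
def singleNode (p : Polarity) (a : Tag) (r : Q) : sig Q :=
  ⟨some (p, ⟨{a}, Finset.singleton_nonempty a⟩), fun _ => r⟩

open Classical in
/-- A choice with a branch for each symbol and a branch with tag `0`. -/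
noncomputable def fullNode (p : Polarity) (d : Q) (k : Γ → Q) : sig Q :=
  ⟨some (p, ⟨insert 0 (Finset.univ.image (tag : Γ → Tag)), Finset.insert_nonempty _ _⟩),
    fun a => if h : ∃ x : Γ, tag x = a.1 then k h.choose else d⟩

theorem branch_leafNode {p : Polarity} {a : Tag} {r : Q} : ¬ Branch leafNode p a r := fun h => h

theorem branch_singleNode {p q : Polarity} {a b : Tag} {r s : Q} :
    Branch (singleNode p a r) q b s ↔ q = p ∧ b = a ∧ s = r := by
  simp [Branch, singleNode]

theorem branch_fullNode {p q : Polarity} {a : Tag} {d r : Q} {k : Γ → Q} :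
    Branch (fullNode p d k) q a r ↔ q = p ∧ ((a = 0 ∧ r = d) ∨ ∃ x, a = tag x ∧ r = k x) := by
  have hk : ∀ x : Γ, ∀ h : ∃ y : Γ, tag y = tag x, h.choose = x := fun x h =>
    tag_injective h.choose_spec
  refine and_congr_right' (a := q = p) ?_
  constructor
  · rintro ⟨h, rfl⟩
    rcases Finset.mem_insert.1 h with rfl | h
    · refine Or.inl ⟨rfl, dif_neg ?_⟩
      rintro ⟨x, hx⟩
      exact tag_ne_zero x hx
    · obtain ⟨x, -, rfl⟩ := Finset.mem_image.1 h
      refine Or.inr ⟨x, rfl, (dif_pos ⟨x, rfl⟩).trans ?_⟩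
      rw [hk]
  · rintro (⟨rfl, rfl⟩ | ⟨x, rfl, rfl⟩)
    · have h0 : ¬ ∃ x : Γ, tag x = 0 := fun ⟨x, hx⟩ => tag_ne_zero x hx
      refine ⟨Finset.mem_insert_self _ _, ?_⟩
      dsimp only
      rw [dif_neg h0]
    · refine ⟨Finset.mem_insert_of_mem (Finset.mem_image_of_mem _ (Finset.mem_univ _)), ?_⟩
      refine ((dif_pos ⟨x, rfl⟩).trans ?_).symm
      rw [hk]

end Nodes

/-! ### Reductions and correctness -/

/-- The configuration that has terminated successfully. -/
noncomputable abbrev Config.final : Config := ⟨Tree.done, [], Tree.done, []⟩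

theorem red_iff {S T : Tree} {u v : List Tag} {C : Config} :
    Red ⟨S, u, T, v⟩ C ↔
      (∃ a S', Step S .output a S' ∧ C = ⟨S', u, T, v ++ [a]⟩) ∨
      (∃ a S' u', Step S .input a S' ∧ u = a :: u' ∧ C = ⟨S', u', T, v⟩) ∨
      (∃ a T', Step T .output a T' ∧ C = ⟨S, u ++ [a], T', v⟩) ∨
      (∃ a T' v', Step T .input a T' ∧ v = a :: v' ∧ C = ⟨S, u, T', v'⟩) := by
  constructor
  · intro h
    cases h with
    | leftOutput h => exact Or.inl ⟨_, _, h, rfl⟩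
    | leftInput h => exact Or.inr (Or.inl ⟨_, _, _, h, rfl, rfl⟩)
    | rightOutput h => exact Or.inr (Or.inr (Or.inl ⟨_, _, h, rfl⟩))
    | rightInput h => exact Or.inr (Or.inr (Or.inr ⟨_, _, _, h, rfl, rfl⟩))
  · rintro (⟨a, S', h, rfl⟩ | ⟨a, S', u', h, rfl, rfl⟩ | ⟨a, T', h, rfl⟩ | ⟨a, T', v', h, rfl, rfl⟩)
    exacts [.leftOutput h, .leftInput h, .rightOutput h, .rightInput h]

theorem Config.Correct.red {C C' : Config} (hC : C.Correct) (h : Red C C') : C'.Correct :=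
  fun _ h' => hC _ (ReflTransGen.head h h')

theorem Config.Correct.exists_red {C : Config} (hC : C.Correct) (h : C ≠ Config.final) :
    ∃ C', Red C C' := by
  rcases ReflTransGen.cases_head (hC C .refl) with rfl | ⟨C', h', _⟩
  · exact absurd rfl h
  · exact ⟨C', h'⟩

theorem Config.not_correct_of_invariant {I : Config → Prop} (hI : ∀ C C', I C → Red C C' → I C')
    (hfinal : ¬ I Config.final) {C : Config} (hC : I C) : ¬ C.Correct := by
  intro h
  refine hfinal ?_
  have hreach : ReflTransGen Red C Config.final := h C .refl
  generalize Config.final = D at hreach ⊢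
  induction hreach with
  | refl => exact hC
  | tail _ hs ih => exact hI _ _ ih hs

/-- Nothing consumes a message addressed to `end`, so its queue never becomes empty. -/
theorem not_correct_of_right_done {R : Tree} {u v : List Tag} {a : Tag} :
    ¬ Config.Correct ⟨R, u, Tree.done, a :: v⟩ := by
  refine Config.not_correct_of_invariant
    (I := fun C => C.right = Tree.done ∧ C.rightQueue ≠ []) ?_ (by simp) (by simp)
  rintro ⟨S, u, T, v⟩ C' ⟨rfl, hv⟩ h
  rcases red_iff.1 h with ⟨a, S', hs, rfl⟩ | ⟨a, S', u', hs, rfl, rfl⟩ | ⟨a, T', hs, rfl⟩ |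
    ⟨a, T', v', hs, rfl, rfl⟩
  · exact ⟨rfl, by simp⟩
  · exact ⟨rfl, hv⟩
  · exact absurd hs not_step_done
  · exact absurd hs not_step_done

/-- A partner that only waits for a tag other than the first one in its queue is stuck. -/
theorem not_correct_of_right_blocked {R W : Tree} {u v : List Tag} {a b : Tag} (hab : a ≠ b)
    (hW : ∀ p c W', Step W p c W' → p = .input ∧ c = b) (hW' : W ≠ Tree.done) :
    ¬ Config.Correct ⟨R, u, W, a :: v⟩ := by
  refine Config.not_correct_of_invariant
    (I := fun C => C.right = W ∧ ∃ v, C.rightQueue = a :: v) ?_ ?_ ⟨rfl, v, rfl⟩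
  · rintro ⟨S, u, T, v⟩ C' ⟨rfl, w, hv⟩ h
    dsimp only at hv hW
    subst hv
    rcases red_iff.1 h with ⟨c, S', hs, rfl⟩ | ⟨c, S', u', hs, rfl, rfl⟩ | ⟨c, T', hs, rfl⟩ |
      ⟨c, T', v', hs, hc, rfl⟩
    · exact ⟨rfl, w ++ [c], rfl⟩
    · exact ⟨rfl, w, rfl⟩
    · cases (hW _ _ _ hs).1
    · cases hc
      exact absurd (hW _ _ _ hs).2 hab
  · rintro ⟨h, -⟩
    exact hW' h.symm

/-! ### The type that forces its partner to echo -/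

section Echo

/-- The states of a partner that takes part in an echo. -/
inductive EchoState (Γ : Type) : Type
  | ready
  | busy (x : Γ)
  | stopped

theorem EchoState.finite (Γ : Type) [Finite Γ] : Finite (EchoState Γ) := by
  refine Finite.of_surjective (α := Option (Option Γ))
    (fun | none => .ready | some none => .stopped | some (some x) => .busy x) ?_
  rintro (_ | x | _)
  exacts [⟨none, rfl⟩, ⟨some (some x), rfl⟩, ⟨some none, rfl⟩]

/-- The opposite polarity. -/
def Polarity.dual : Polarity → Polarity
  | .input => .output
  | .output => .input

variable {Γ : Type} [Fintype Γ]

/-- The equations `X = ∑ₓ p x.(p̄ x.X) + p 0.end`. -/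
noncomputable def echoNode (p : Polarity) : EchoState Γ → sig (EchoState Γ)
  | .ready => fullNode p .stopped .busy
  | .busy x => singleNode p.dual (tag x) .ready
  | .stopped => leafNode

/-- The solutions of `X = ∑ₓ p x.(p̄ x.X) + p 0.end`. -/
noncomputable def echoTree (p : Polarity) (s : EchoState Γ) : Tree := unfold (echoNode p) s

theorem echoTree_stopped (p : Polarity) : echoTree p (.stopped : EchoState Γ) = Tree.done :=
  unfold_eq_done rfl

theorem step_ready_iff {p q : Polarity} {a : Tag} {S : Tree} :
    Step (echoTree p (.ready : EchoState Γ)) q a S ↔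
      q = p ∧ ((a = 0 ∧ S = Tree.done) ∨ ∃ x : Γ, a = tag x ∧ S = echoTree p (.busy x)) := by
  rw [echoTree, step_unfold_iff, echoNode]
  simp only [branch_fullNode]
  constructor
  · rintro ⟨r, ⟨rfl, ⟨rfl, rfl⟩ | ⟨x, rfl, rfl⟩⟩, rfl⟩
    · exact ⟨rfl, Or.inl ⟨rfl, echoTree_stopped _⟩⟩
    · exact ⟨rfl, Or.inr ⟨x, rfl, rfl⟩⟩
  · rintro ⟨rfl, ⟨rfl, rfl⟩ | ⟨x, rfl, rfl⟩⟩
    · exact ⟨_, ⟨rfl, Or.inl ⟨rfl, rfl⟩⟩, (echoTree_stopped _).symm⟩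
    · exact ⟨_, ⟨rfl, Or.inr ⟨x, rfl, rfl⟩⟩, rfl⟩

theorem step_busy_iff {p q : Polarity} {x : Γ} {a : Tag} {S : Tree} :
    Step (echoTree p (.busy x)) q a S ↔
      q = p.dual ∧ a = tag x ∧ S = echoTree p (.ready : EchoState Γ) := by
  rw [echoTree, step_unfold_iff, echoNode]
  simp only [branch_singleNode]
  constructor
  · rintro ⟨r, ⟨rfl, rfl, rfl⟩, rfl⟩
    exact ⟨rfl, rfl, rfl⟩
  · rintro ⟨rfl, rfl, rfl⟩
    exact ⟨_, ⟨rfl, rfl, rfl⟩, rfl⟩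

theorem echoTree_busy_ne_done {p : Polarity} {x : Γ} : echoTree p (.busy x) ≠ Tree.done := by
  intro h
  have : Step (echoTree p (.busy x)) p.dual (tag x) (echoTree p (.ready : EchoState Γ)) :=
    step_busy_iff.2 ⟨rfl, rfl, rfl⟩
  rw [h] at this
  exact not_step_done this

variable (Γ) in
theorem wellFormed_echoTree (p : Polarity) (s : EchoState Γ) : WellFormed (echoTree p s) := by
  refine wellFormed_unfold ?_ s
  have hready : Subtree (echoTree p (.ready : EchoState Γ)) Tree.done :=
    ReflTransGen.single ⟨_, _, step_ready_iff.2 ⟨rfl, Or.inl ⟨rfl, rfl⟩⟩⟩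
  rintro (_ | x | _)
  · exact hready
  · exact ReflTransGen.head ⟨_, _, step_busy_iff.2 ⟨rfl, rfl, rfl⟩⟩ hready
  · rw [show unfold (echoNode p) (.stopped : EchoState Γ) = Tree.done from echoTree_stopped p]
    exact ReflTransGen.refl

variable (Γ) in
/-- `X = ∑ₓ p x.(p̄ x.X) + p 0.end` as a session type. -/
noncomputable def echoType (p : Polarity) : SessionType :=
  ⟨echoTree p (.ready : EchoState Γ), wellFormed_echoTree Γ p _⟩

variable (Γ) in
theorem regular_echoType (p : Polarity) : (echoType Γ p).Regular :=
  have := EchoState.finite Γ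
  regular_unfold _

variable (Γ) in
theorem exists_presents_echoType (p : Polarity) : ∃ sys, Presents sys (echoType Γ p) :=
  have := EchoState.finite Γ
  exists_presents (echoNode p) (wellFormed_echoTree Γ p) Set.univ Set.finite_univ
    (fun _ _ _ _ _ _ => Set.mem_univ _) .ready (Set.mem_univ _)

variable (Γ) in
/-- The partners of `X = ∑ₓ !x.?x.X + !0.end`. -/
def Echo (R : Tree) : Prop :=
  Config.Correct ⟨R, [], echoTree .output (.ready : EchoState Γ), []⟩

theorem Echo.correct_stopped {R : Tree} (h : Echo Γ R) :
    Config.Correct ⟨R, [0], Tree.done, []⟩ :=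
  Config.Correct.red h (Red.rightOutput (step_ready_iff.2 ⟨rfl, Or.inl ⟨rfl, rfl⟩⟩))

theorem Echo.correct_busy {R : Tree} (h : Echo Γ R) (x : Γ) :
    Config.Correct ⟨R, [tag x], echoTree .output (.busy x), []⟩ :=
  Config.Correct.red h (Red.rightOutput (step_ready_iff.2 ⟨rfl, Or.inr ⟨x, rfl, rfl⟩⟩))

/-- The other side may choose `0` and become `end` before any output of `R`, which would then stay
in its queue forever. -/
theorem Echo.polarity_eq {R R' : Tree} {p : Polarity} {a : Tag} (h : Echo Γ R)
    (hs : Step R p a R') : p = .input := by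
  cases p with
  | input => rfl
  | output => exact absurd (h.correct_stopped.red (.leftOutput hs)) not_correct_of_right_done

/-- Once the other side has stopped, `R` must consume the `0`. Afterwards its queue is empty for
good, and an output would never be read, so it can only be `end`. -/
theorem Echo.step_zero {R : Tree} (h : Echo Γ R) : Step R .input 0 Tree.done := by
  have h0 := h.correct_stopped
  obtain ⟨C, hC⟩ := h0.exists_red (by simp [Config.final])
  have h1 := h0.red hC
  rcases red_iff.1 hC with ⟨a, S', hs, rfl⟩ | ⟨a, R', u', hs, hu, rfl⟩ | ⟨a, T', hs, rfl⟩ |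
    ⟨a, T', v', hs, hv, rfl⟩
  · cases h.polarity_eq hs
  · cases hu
    by_cases hR : R' = Tree.done
    · rwa [← hR]
    · exfalso
      obtain ⟨C, hC⟩ := h1.exists_red (by simpa [Config.final] using hR)
      have h2 := h1.red hC
      rcases red_iff.1 hC with ⟨a, S', hs, rfl⟩ | ⟨a, S', u', hs, hu, rfl⟩ | ⟨a, T', hs, rfl⟩ |
        ⟨a, T', v', hs, hv, rfl⟩
      · exact not_correct_of_right_done h2
      · cases hu
      · exact not_step_done hs
      · exact not_step_done hs
  · exact absurd hs not_step_done
  · exact absurd hs not_step_done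

theorem Echo.ne_done {R : Tree} (h : Echo Γ R) : R ≠ Tree.done := by
  rintro rfl
  exact not_step_done h.step_zero

theorem Echo.exists_step {R : Tree} (h : Echo Γ R) (x : Γ) : ∃ R', Step R .input (tag x) R' := by
  have h0 := h.correct_busy x
  obtain ⟨C, hC⟩ := h0.exists_red (by simp [Config.final])
  rcases red_iff.1 hC with ⟨a, S', hs, rfl⟩ | ⟨a, R', u', hs, hu, rfl⟩ | ⟨a, T', hs, rfl⟩ |
    ⟨a, T', v', hs, hv, rfl⟩
  · cases h.polarity_eq hs
  · cases hu
    exact ⟨R', hs⟩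
  · cases (step_busy_iff.1 hs).1
  · cases hv

theorem Echo.correct_hold {R R' : Tree} {x : Γ} (h : Echo Γ R) (hs : Step R .input (tag x) R') :
    Config.Correct ⟨R', [], echoTree .output (.busy x), []⟩ :=
  (h.correct_busy x).red (.leftInput hs)

theorem Echo.exists_step_hold {R R' : Tree} {x : Γ} (h : Echo Γ R)
    (hs : Step R .input (tag x) R') : ∃ a R'', Step R' .output a R'' := by
  have h0 := h.correct_hold hs
  obtain ⟨C, hC⟩ := h0.exists_red (by simp [Config.final, echoTree_busy_ne_done])
  rcases red_iff.1 hC with ⟨a, S', hs, rfl⟩ | ⟨a, R', u', hs, hu, rfl⟩ | ⟨a, T', hs, rfl⟩ |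
    ⟨a, T', v', hs, hv, rfl⟩
  · exact ⟨a, S', hs⟩
  · cases hu
  · cases (step_busy_iff.1 hs).1
  · cases hv

/-- A wrong answer blocks the other side forever. The right answer, once consumed, restores the
initial form of the configuration, so the echo property passes to the continuation. -/
theorem Echo.step_hold {R R' R'' : Tree} {x : Γ} {p : Polarity} {a : Tag} (h : Echo Γ R)
    (hs : Step R .input (tag x) R') (hs' : Step R' p a R'') :
    p = .output ∧ a = tag x ∧ Echo Γ R'' := by
  obtain ⟨b, S, hS⟩ := h.exists_step_hold hs
  obtain rfl := hs'.polarity_unique hS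
  have h1 := (h.correct_hold hs).red (.leftOutput hs')
  by_cases ha : a = tag x
  · subst ha
    exact ⟨rfl, rfl, h1.red (.rightInput (step_busy_iff.2 ⟨rfl, rfl, rfl⟩))⟩
  · refine absurd h1 (not_correct_of_right_blocked ha ?_ echoTree_busy_ne_done)
    intro p c W hW
    obtain ⟨rfl, rfl, -⟩ := step_busy_iff.1 hW
    exact ⟨rfl, rfl⟩

variable (Γ) in
/-- The configurations that `X = ∑ₓ ?x.!x.X + ?0.end` and its dual can reach. -/
inductive EchoConfig : Config → Prop
  | ready : EchoConfig ⟨echoTree .input (.ready : EchoState Γ), [],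
      echoTree .output (.ready : EchoState Γ), []⟩
  | sent (x : Γ) : EchoConfig ⟨echoTree .input (.ready : EchoState Γ), [tag x],
      echoTree .output (.busy x), []⟩
  | received (x : Γ) : EchoConfig ⟨echoTree .input (.busy x), [], echoTree .output (.busy x), []⟩
  | answered (x : Γ) : EchoConfig ⟨echoTree .input (.ready : EchoState Γ), [],
      echoTree .output (.busy x), [tag x]⟩
  | stopping : EchoConfig ⟨echoTree .input (.ready : EchoState Γ), [0], Tree.done, []⟩
  | stopped : EchoConfig Config.final

theorem EchoConfig.red {C C' : Config} (hC : EchoConfig Γ C) (h : Red C C') : EchoConfig Γ C' := by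
  cases hC <;>
    rcases red_iff.1 h with ⟨a, S', hs, rfl⟩ | ⟨a, S', u', hs, hu, rfl⟩ | ⟨a, T', hs, rfl⟩ |
      ⟨a, T', v', hs, hv, rfl⟩
  case ready.inl => cases (step_ready_iff.1 hs).1
  case ready.inr.inl => cases hu
  case ready.inr.inr.inl =>
    obtain ⟨-, ⟨rfl, rfl⟩ | ⟨x, rfl, rfl⟩⟩ := step_ready_iff.1 hs
    exacts [.stopping, .sent x]
  case ready.inr.inr.inr => cases hv
  case sent.inl => cases (step_ready_iff.1 hs).1
  case sent.inr.inl x =>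
    cases hu
    obtain ⟨-, ⟨hx, -⟩ | ⟨y, hx, rfl⟩⟩ := step_ready_iff.1 hs
    · exact absurd hx (tag_ne_zero x)
    · cases tag_injective hx
      exact .received x
  case sent.inr.inr.inl => cases (step_busy_iff.1 hs).1
  case sent.inr.inr.inr => cases hv
  case received.inl x =>
    obtain ⟨-, rfl, rfl⟩ := step_busy_iff.1 hs
    exact .answered x
  case received.inr.inl => cases hu
  case received.inr.inr.inl => cases (step_busy_iff.1 hs).1
  case received.inr.inr.inr => cases hv
  case answered.inl => cases (step_ready_iff.1 hs).1
  case answered.inr.inl => cases hu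
  case answered.inr.inr.inl => cases (step_busy_iff.1 hs).1
  case answered.inr.inr.inr =>
    cases hv
    obtain ⟨-, -, rfl⟩ := step_busy_iff.1 hs
    exact .ready
  case stopping.inl => cases (step_ready_iff.1 hs).1
  case stopping.inr.inl =>
    cases hu
    obtain ⟨-, ⟨-, rfl⟩ | ⟨y, h, -⟩⟩ := step_ready_iff.1 hs
    · exact .stopped
    · exact absurd h.symm (tag_ne_zero y)
  all_goals exact absurd hs not_step_done

theorem EchoConfig.reaches_final {C : Config} (hC : EchoConfig Γ C) :
    ReflTransGen Red C Config.final := by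
  have h1 : ReflTransGen Red ⟨echoTree .input (.ready : EchoState Γ), [0], Tree.done, []⟩
      Config.final :=
    .single (.leftInput (step_ready_iff.2 ⟨rfl, Or.inl ⟨rfl, rfl⟩⟩))
  have h2 := h1.head (.rightOutput (S := echoTree .input (.ready : EchoState Γ)) (u := [])
    (v := []) (step_ready_iff (Γ := Γ).2 ⟨rfl, Or.inl ⟨rfl, rfl⟩⟩))
  have h3 := fun x : Γ => h2.head (.rightInput (step_busy_iff (x := x).2 ⟨rfl, rfl, rfl⟩))
  have h4 := fun x : Γ => (h3 x).head
    (.leftOutput (v := []) (step_busy_iff (x := x).2 ⟨rfl, rfl, rfl⟩))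
  have h5 := fun x : Γ => (h4 x).head
    (.leftInput (step_ready_iff.2 ⟨rfl, Or.inr ⟨x, rfl, rfl⟩⟩))
  cases hC with
  | ready => exact h2
  | sent x => exact h5 x
  | received x => exact h4 x
  | answered x => exact h3 x
  | stopping => exact h1
  | stopped => exact .refl

-- At least one echoing partner exists, and it is regular; otherwise refinement could hold
-- vacuously.
variable (Γ) in
theorem compliant_echoType : Compliant (echoType Γ .input) (echoType Γ .output) := by
  intro C hC
  have : EchoConfig Γ C := by
    induction hC with
    | refl => exact .ready
    | tail _ h ih => exact ih.red h
  exact this.reaches_final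

end Echo

/-! ### Queue machines

A queue machine repeatedly removes the first symbol of a word and appends a word that depends on
that symbol and on its control state; the control state `none` is halting. -/

section QueueMachine

variable {Γ P : Type}

/-- One step of a queue machine. -/
def queueStep (δ : P → Γ → List Γ × Option P) : Option P × List Γ → Option (Option P × List Γ)
  | (some p, x :: w) => some ((δ p x).2, w ++ (δ p x).1)
  | (_, _) => none

variable [Fintype Γ]

/-- The driver of a queue machine whose queue is kept by an echoing partner: in a state
`some (l, p)` it still has to send `l` before it is in the control state `p`. -/
noncomputable def driverNode (δ : P → Γ → List Γ × Option P) :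
    Option (List Γ × Option P) → sig (Option (List Γ × Option P))
  | none => leafNode
  | some (x :: l, p) => singleNode .output (tag x) (some (l, p))
  | some ([], some p) => fullNode .input none fun x => some (δ p x)
  | some ([], none) => singleNode .output 0 none

/-- The tree of the driver of a queue machine. -/
noncomputable def driverTree (δ : P → Γ → List Γ × Option P) (s : Option (List Γ × Option P)) :
    Tree :=
  unfold (driverNode δ) s

variable {δ : P → Γ → List Γ × Option P}

theorem driverTree_none : driverTree δ none = Tree.done := unfold_eq_done rfl

theorem step_driver_cons_iff {x : Γ} {l : List Γ} {p : Option P} {q : Polarity} {a : Tag}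
    {S : Tree} : Step (driverTree δ (some (x :: l, p))) q a S ↔
      q = .output ∧ a = tag x ∧ S = driverTree δ (some (l, p)) := by
  rw [driverTree, step_unfold_iff, driverNode]
  simp only [branch_singleNode]
  constructor
  · rintro ⟨r, ⟨rfl, rfl, rfl⟩, rfl⟩
    exact ⟨rfl, rfl, rfl⟩
  · rintro ⟨rfl, rfl, rfl⟩
    exact ⟨_, ⟨rfl, rfl, rfl⟩, rfl⟩

theorem step_driver_halted_iff {q : Polarity} {a : Tag} {S : Tree} :
    Step (driverTree δ (some ([], none))) q a S ↔ q = .output ∧ a = 0 ∧ S = Tree.done := by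
  rw [driverTree, step_unfold_iff, driverNode]
  simp only [branch_singleNode]
  constructor
  · rintro ⟨r, ⟨rfl, rfl, rfl⟩, rfl⟩
    exact ⟨rfl, rfl, driverTree_none⟩
  · rintro ⟨rfl, rfl, rfl⟩
    exact ⟨_, ⟨rfl, rfl, rfl⟩, driverTree_none.symm⟩

theorem step_driver_read_iff {p : P} {q : Polarity} {a : Tag} {S : Tree} :
    Step (driverTree δ (some ([], some p))) q a S ↔ q = .input ∧
      ((a = 0 ∧ S = Tree.done) ∨ ∃ x, a = tag x ∧ S = driverTree δ (some (δ p x))) := by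
  rw [driverTree, step_unfold_iff, driverNode]
  simp only [branch_fullNode]
  constructor
  · rintro ⟨r, ⟨rfl, ⟨rfl, rfl⟩ | ⟨x, rfl, rfl⟩⟩, rfl⟩
    · exact ⟨rfl, Or.inl ⟨rfl, driverTree_none⟩⟩
    · exact ⟨rfl, Or.inr ⟨x, rfl, rfl⟩⟩
  · rintro ⟨rfl, ⟨rfl, rfl⟩ | ⟨x, rfl, rfl⟩⟩
    · exact ⟨_, ⟨rfl, Or.inl ⟨rfl, rfl⟩⟩, driverTree_none.symm⟩
    · exact ⟨_, ⟨rfl, Or.inr ⟨x, rfl, rfl⟩⟩, rfl⟩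

/-- Reading states have a branch `0` to `end` solely for this purpose: an echoing partner never
sends `0`. -/
theorem wellFormed_driverTree (δ : P → Γ → List Γ × Option P) (s : Option (List Γ × Option P)) :
    WellFormed (driverTree δ s) := by
  refine wellFormed_unfold (fun s => ?_) s
  change Subtree (driverTree δ s) _
  rcases s with _ | ⟨l, p⟩
  · rw [driverTree_none]
    exact ReflTransGen.refl
  · induction l with
    | nil =>
      cases p with
      | none => exact ReflTransGen.single ⟨_, _, step_driver_halted_iff.2 ⟨rfl, rfl, rfl⟩⟩
      | some p =>
        exact ReflTransGen.single ⟨_, _, step_driver_read_iff.2 ⟨rfl, Or.inl ⟨rfl, rfl⟩⟩⟩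
    | cons x l ih =>
      exact ReflTransGen.head ⟨_, _, step_driver_cons_iff.2 ⟨rfl, rfl, rfl⟩⟩ ih

/-- The session type of the driver of a queue machine. -/
noncomputable def driverType (δ : P → Γ → List Γ × Option P) (b : List Γ × Option P) :
    SessionType :=
  ⟨driverTree δ (some b), wellFormed_driverTree δ _⟩

/-- The states in use are `none` and pairs of a control state with a suffix of the initial word or
of some word `δ p x` with `p ∈ X`; there are finitely many. -/
theorem exists_presents_driverType (δ : P → Γ → List Γ × Option P) (X : Set P) (hX : X.Finite)
    (hclosed : ∀ p ∈ X, ∀ x, ∀ p' ∈ (δ p x).2, p' ∈ X) (b : List Γ × Option P)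
    (hb : ∀ p ∈ b.2, p ∈ X) : ∃ sys, Presents sys (driverType δ b) := by
  let B : Set (List Γ × Option P) := insert b (⋃ p ∈ X, Set.range (δ p))
  have hB : B.Finite := (hX.biUnion fun p _ => Set.finite_range (δ p)).insert _
  have hBX : ∀ c ∈ B, ∀ p ∈ c.2, p ∈ X := by
    rintro c (rfl | hc)
    · exact hb
    · obtain ⟨p, hp, x, rfl⟩ := Set.mem_iUnion₂.1 hc
      exact hclosed p hp x
  refine exists_presents (driverNode δ) (wellFormed_driverTree δ)
    (insert none (⋃ c ∈ B, (fun l => some (l, c.2)) '' {l | l ∈ c.1.tails})) ?_ ?_ (some b) ?_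
  · exact (hB.biUnion fun c _ => c.1.tails.finite_toSet.image _).insert _
  · intro s hs q a r hr
    rcases hs with rfl | hs
    · exact absurd hr branch_leafNode
    · obtain ⟨c, hc, l, hl, rfl⟩ := Set.mem_iUnion₂.1 hs
      have hl : l ∈ c.1.tails := hl
      rw [List.mem_tails] at hl
      rcases l with _ | ⟨x, l⟩
      · rcases hcp : c.2 with _ | p
        · simp only [hcp, driverNode, branch_singleNode] at hr
          exact Or.inl hr.2.2
        · simp only [hcp, driverNode, branch_fullNode] at hr
          rcases hr.2 with ⟨-, rfl⟩ | ⟨x, -, rfl⟩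
          · exact Or.inl rfl
          · refine Or.inr (Set.mem_iUnion₂.2 ⟨δ p x, Or.inr ?_, (δ p x).1, by simp, rfl⟩)
            exact Set.mem_iUnion₂.2 ⟨p, hBX c hc p hcp, x, rfl⟩
      · simp only [driverNode, branch_singleNode] at hr
        obtain ⟨-, -, rfl⟩ := hr
        refine Or.inr (Set.mem_iUnion₂.2 ⟨c, hc, l, ?_, rfl⟩)
        exact (List.mem_tails _ _).2 ((List.suffix_cons x l).trans hl)
  · exact Or.inr (Set.mem_iUnion₂.2 ⟨b, Or.inl rfl, b.1, by simp, rfl⟩)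

theorem presents_driverType_cons {sys : System} {x : Γ} {l : List Γ} {p : Option P}
    (h : Presents sys (driverType δ (l, p))) :
    Presents (consSystem (tag x) sys) (driverType δ (x :: l, p)) :=
  presents_consSystem h fun _ _ _ => step_driver_cons_iff

/-! ### The driver simulates its queue machine -/

/-- What a driver has sent after the symbols of the queue. -/
def endMark : Option (List Γ × Option P) → List Tag
  | none => [0]
  | some _ => []

/-- The configuration of the queue machine given by a state of the driver and the symbols that are
in transit. -/
def machineConfig (s : Option (List Γ × Option P)) (w : List Γ) : Option P × List Γ :=
  match s with
  | none => (none, w)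
  | some (l, p) => (p, w ++ l)

/-- The configurations of an echoing partner and a driver, with the configurations of the queue
machine that they implement. -/
inductive Simulates (δ : P → Γ → List Γ × Option P) : Config → Option P × List Γ → Prop
  | idle {R : Tree} (hR : Echo Γ R) (s : Option (List Γ × Option P)) (u v : List Γ) :
      Simulates δ ⟨R, u.map tag ++ endMark s, driverTree δ s, v.map tag⟩ (machineConfig s (v ++ u))
  | hold {R R' : Tree} (hR : Echo Γ R) (x : Γ) (h : Step R .input (tag x) R')
      (s : Option (List Γ × Option P)) (u v : List Γ) :
      Simulates δ ⟨R', u.map tag ++ endMark s, driverTree δ s, v.map tag⟩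
        (machineConfig s (v ++ x :: u))
  | stopped (w : List Γ) : Simulates δ ⟨Tree.done, [], Tree.done, w.map tag⟩ (none, w)

/-- A step of the driver, where `y` are the symbols held or not yet received by the partner. -/
theorem driver_red {S' : Tree} {q : Polarity} {a : Tag} {s : Option (List Γ × Option P)}
    (h : Step (driverTree δ s) q a S') (u y v : List Γ) :
    (q = .output ∧ ∃ s' u', S' = driverTree δ s' ∧
      u.map tag ++ endMark s ++ [a] = u'.map tag ++ endMark s' ∧
      machineConfig s (v ++ y ++ u) = machineConfig s' (v ++ y ++ u')) ∨
    (q = .input ∧ ∀ v', v.map tag = a :: v' → ∃ s' w, S' = driverTree δ s' ∧ v' = w.map tag ∧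
      endMark s' = endMark s ∧
      queueStep δ (machineConfig s (v ++ y ++ u)) = some (machineConfig s' (w ++ y ++ u))) := by
  rcases s with _ | ⟨_ | ⟨x, l⟩, _ | p⟩
  · rw [driverTree_none] at h
    exact absurd h not_step_done
  · obtain ⟨rfl, rfl, rfl⟩ := step_driver_halted_iff.1 h
    exact Or.inl ⟨rfl, none, u, driverTree_none.symm, by simp [endMark], by simp [machineConfig]⟩
  · obtain ⟨rfl, ha⟩ := step_driver_read_iff.1 h
    refine Or.inr ⟨rfl, fun v' hv => ?_⟩
    rcases v with _ | ⟨z, v⟩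
    · cases hv
    · rw [List.map_cons, List.cons.injEq] at hv
      obtain ⟨rfl, rfl⟩ := hv
      rcases ha with ⟨hz, -⟩ | ⟨x, hx, rfl⟩
      · exact absurd hz (tag_ne_zero z)
      · cases tag_injective hx
        exact ⟨_, v, rfl, rfl, rfl, by simp [machineConfig, queueStep]⟩
  all_goals
    obtain ⟨rfl, rfl, rfl⟩ := step_driver_cons_iff.1 h
    exact Or.inl ⟨rfl, _, u ++ [x], rfl, by simp [endMark], by simp [machineConfig]⟩

/-- From oldest to newest, the queue of the machine is the driver's inbox, the symbol held by the
partner, the partner's inbox, and the word still to be sent. Other moves only shift symbols along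
this sequence; an input of the driver is a step of the machine. -/
theorem Simulates.red {C C' : Config} {m : Option P × List Γ} (hC : Simulates δ C m)
    (h : Red C C') : ∃ m', Simulates δ C' m' ∧ (m' = m ∨ queueStep δ m = some m') := by
  cases hC with
  | idle hR s u v =>
    rcases red_iff.1 h with ⟨a, S', hs, rfl⟩ | ⟨a, S', u', hs, hu, rfl⟩ | ⟨a, T', hs, rfl⟩ |
      ⟨a, T', v', hs, hv, rfl⟩
    · cases hR.polarity_eq hs
    · rcases u with _ | ⟨x, u⟩
      · rcases s with _ | s
        · rw [List.map_nil, List.nil_append, endMark, List.cons.injEq] at hu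
          obtain ⟨rfl, rfl⟩ := hu
          cases hs.deterministic hR.step_zero
          rw [driverTree_none, List.append_nil]
          exact ⟨_, .stopped v, Or.inl rfl⟩
        · cases hu
      · rw [List.map_cons, List.cons_append, List.cons.injEq] at hu
        obtain ⟨rfl, rfl⟩ := hu
        exact ⟨_, .hold hR x hs s u v, Or.inl rfl⟩
    · rcases driver_red hs u [] v with ⟨-, s', u', rfl, hu, hm⟩ | ⟨hq, -⟩
      · rw [hu]
        refine ⟨_, .idle hR s' u' v, Or.inl ?_⟩
        simpa using hm.symm
      · cases hq
    · rcases driver_red hs u [] v with ⟨hq, -⟩ | ⟨-, hv'⟩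
      · cases hq
      · obtain ⟨s', w, rfl, rfl, he, hm⟩ := hv' v' hv
        rw [← he]
        refine ⟨_, .idle hR s' u w, Or.inr ?_⟩
        simpa using hm
  | @hold R R' hR x h' s u v =>
    rcases red_iff.1 h with ⟨a, S', hs, rfl⟩ | ⟨a, S', u', hs, hu, rfl⟩ | ⟨a, T', hs, rfl⟩ |
      ⟨a, T', v', hs, hv, rfl⟩
    · obtain ⟨-, rfl, hR'⟩ := hR.step_hold h' hs
      have hv : v.map tag ++ [tag x] = (v ++ [x]).map tag := by simp
      rw [hv]
      refine ⟨_, .idle hR' s u (v ++ [x]), Or.inl ?_⟩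
      simp
    · cases (hR.step_hold h' hs).1
    · rcases driver_red hs u [x] v with ⟨-, s', u', rfl, hu, hm⟩ | ⟨hq, -⟩
      · rw [hu]
        refine ⟨_, .hold hR x h' s' u' v, Or.inl ?_⟩
        simpa using hm.symm
      · cases hq
    · rcases driver_red hs u [x] v with ⟨hq, -⟩ | ⟨-, hv'⟩
      · cases hq
      · obtain ⟨s', w, rfl, rfl, he, hm⟩ := hv' v' hv
        rw [← he]
        refine ⟨_, .hold hR x h' s' u w, Or.inr ?_⟩
        simpa using hm
  | stopped w =>
    rcases red_iff.1 h with ⟨a, S', hs, rfl⟩ | ⟨a, S', u', hs, hu, rfl⟩ | ⟨a, T', hs, rfl⟩ |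
      ⟨a, T', v', hs, hv, rfl⟩
    all_goals exact absurd hs not_step_done

/-- An echoing partner is not `end`, and one that holds a symbol still has an output. Only the
stopped case with nothing left in the driver's inbox remains. -/
theorem Simulates.eq_of_final {m : Option P × List Γ} (h : Simulates δ Config.final m) :
    m = (none, []) := by
  generalize hC : Config.final = C at h
  cases h with
  | idle hR =>
    cases congrArg Config.left hC
    exact absurd rfl hR.ne_done
  | hold hR x h =>
    cases congrArg Config.left hC
    obtain ⟨a, S, hS⟩ := hR.exists_step_hold h
    exact absurd hS not_step_done
  | stopped w =>
    have := congrArg Config.rightQueue hC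
    rw [List.map_eq_nil_iff.1 this.symm]

/-- The partner can return everything that has been sent to it. -/
theorem echo_flush (s : Option (List Γ × Option P)) (T : Tree) (u : List Γ) :
    ∀ {R : Tree} (v : List Γ), Echo Γ R → ∃ R', Echo Γ R' ∧
      ReflTransGen Red ⟨R, u.map tag ++ endMark s, T, v.map tag⟩
        ⟨R', endMark s, T, (v ++ u).map tag⟩ := by
  induction u with
  | nil =>
    intro R v hR
    refine ⟨R, hR, ?_⟩
    simpa using ReflTransGen.refl
  | cons x u ih =>
    intro R v hR
    obtain ⟨R', h'⟩ := hR.exists_step x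
    obtain ⟨a, R'', h''⟩ := hR.exists_step_hold h'
    obtain ⟨-, rfl, hR''⟩ := hR.step_hold h' h''
    obtain ⟨R₁, h₁, hr⟩ := ih (v ++ [x]) hR''
    refine ⟨R₁, h₁, .head (.leftInput h') (.head (.leftOutput h'') ?_)⟩
    simpa using hr

theorem driver_flush (R : Tree) (u : List Tag) (p : Option P) (v : List Tag) (l : List Γ) :
    ReflTransGen Red ⟨R, u, driverTree δ (some (l, p)), v⟩
      ⟨R, u ++ l.map tag, driverTree δ (some ([], p)), v⟩ := by
  induction l generalizing u with
  | nil => simpa using ReflTransGen.refl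
  | cons x l ih =>
    refine .head (.rightOutput (step_driver_cons_iff.2 ⟨rfl, rfl, rfl⟩)) ?_
    simpa using ih (u ++ [tag x])

theorem echo_driver_flush {R : Tree} (hR : Echo Γ R) (l : List Γ) (p : Option P) (u v : List Γ) :
    ∃ R', Echo Γ R' ∧ ReflTransGen Red ⟨R, u.map tag, driverTree δ (some (l, p)), v.map tag⟩
      ⟨R', [], driverTree δ (some ([], p)), (v ++ u ++ l).map tag⟩ := by
  obtain ⟨R', hR', h⟩ := echo_flush (P := P) (some ([], p)) (driverTree δ (some ([], p)))
    (u ++ l) v hR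
  refine ⟨R', hR', (driver_flush _ _ _ _ _).trans ?_⟩
  simpa [endMark] using h

/-- Before each machine step the driver sends all it has pending and the partner returns everything,
so the whole word lies in the driver's inbox and its first symbol can be read. The partner changes
along the way, hence the quantification over `R`. -/
theorem reaches_final_of_halts {m : Option P × List Γ}
    (hm : StateTransition.Reaches (queueStep δ) m (none, [])) :
    ∀ {R : Tree}, Echo Γ R → ∀ (l u v : List Γ), v ++ u ++ l = m.2 →
      ReflTransGen Red ⟨R, u.map tag, driverTree δ (some (l, m.1)), v.map tag⟩ Config.final := by
  induction hm using ReflTransGen.head_induction_on with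
  | refl =>
    intro R hR l u v hw
    simp only [List.append_eq_nil_iff] at hw
    obtain ⟨⟨rfl, rfl⟩, rfl⟩ := hw
    exact .head (.rightOutput (step_driver_halted_iff.2 ⟨rfl, rfl, rfl⟩))
      (.single (.leftInput hR.step_zero))
  | @head m m' hstep _ ih =>
    intro R hR l u v hw
    obtain ⟨R', hR', h⟩ := echo_driver_flush (δ := δ) hR l m.1 u v
    refine h.trans ?_
    rw [hw]
    rcases m with ⟨_ | p, _ | ⟨x, w⟩⟩
    · cases hstep
    · cases hstep
    · cases hstep
    · obtain rfl := Option.some.inj hstep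
      refine .head (.rightInput (step_driver_read_iff.2 ⟨rfl, Or.inr ⟨x, rfl, rfl⟩⟩)) ?_
      exact ih hR' (δ p x).1 [] w (by simp)

theorem Simulates.reaches_final {C : Config} {m : Option P × List Γ} (hC : Simulates δ C m)
    (hm : StateTransition.Reaches (queueStep δ) m (none, [])) :
    ReflTransGen Red C Config.final := by
  have hidle : ∀ {R : Tree}, Echo Γ R → ∀ s u v,
      StateTransition.Reaches (queueStep δ) (machineConfig s (v ++ u)) (none, []) →
      ReflTransGen Red ⟨R, u.map tag ++ endMark s, driverTree δ s, v.map tag⟩ Config.final := by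
    intro R hR s u v hm
    rcases s with _ | ⟨l, p⟩
    -- The driver has stopped, so the machine is in a halted configuration without successor, which
    -- must be the accepting one.
    · have hw : v ++ u = [] := by
        rcases ReflTransGen.cases_head hm with h | ⟨m', h, _⟩
        · exact congrArg Prod.snd h
        · cases h
      obtain ⟨rfl, rfl⟩ := List.append_eq_nil_iff.1 hw
      rw [driverTree_none]
      exact .single (.leftInput hR.step_zero)
    · have := reaches_final_of_halts hm hR l u v rfl
      simpa [endMark, machineConfig] using this
  cases hC with
  | idle hR s u v => exact hidle hR s u v hm
  | @hold R R' hR x h' s u v =>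
    obtain ⟨a, R'', h''⟩ := hR.exists_step_hold h'
    obtain ⟨-, rfl, hR''⟩ := hR.step_hold h' h''
    refine .head (.leftOutput h'') ?_
    have := hidle hR'' s u (v ++ [x]) (by simpa using hm)
    simpa using this
  | stopped w =>
    rcases ReflTransGen.cases_head hm with h | ⟨m', h, _⟩
    · cases h
      exact .refl
    · cases h

/-- Every reachable configuration represents a point on the run of the machine. As the machine is
deterministic and `(none, [])` has no successor, a halting run can be completed from any such point.
-/
theorem correct_driver_iff {R : Tree} (hR : Echo Γ R) (b : List Γ × Option P) :
    Config.Correct ⟨R, [], driverTree δ (some b), []⟩ ↔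
      StateTransition.Reaches (queueStep δ) (b.2, b.1) (none, []) := by
  have h0 : Simulates δ ⟨R, [], driverTree δ (some b), []⟩ (b.2, b.1) :=
    .idle hR (some b) [] []
  have hreach : ∀ C, ReflTransGen Red ⟨R, [], driverTree δ (some b), []⟩ C →
      ∃ m, Simulates δ C m ∧ StateTransition.Reaches (queueStep δ) (b.2, b.1) m := by
    intro C hC
    induction hC with
    | refl => exact ⟨_, h0, .refl⟩
    | tail _ h ih =>
      obtain ⟨m, hm, hr⟩ := ih
      obtain ⟨m', hm', rfl | hs⟩ := hm.red h
      · exact ⟨_, hm', hr⟩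
      · exact ⟨_, hm', hr.tail hs⟩
  constructor
  · intro h
    obtain ⟨m, hm, hr⟩ := hreach _ (h _ .refl)
    rwa [hm.eq_of_final] at hr
  · intro hb C hC
    obtain ⟨m, hm, hr⟩ := hreach C hC
    refine hm.reaches_final ?_
    rcases StateTransition.reaches_total hr hb with h | h
    · exact h
    · rcases ReflTransGen.cases_head h with rfl | ⟨m', h', _⟩
      · exact .refl
      · cases h'

theorem refines_driver_iff (b : List Γ × Option P) :
    Refines (driverType δ b) (echoType Γ .output) ↔
      StateTransition.Reaches (queueStep δ) (b.2, b.1) (none, []) :=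
  ⟨fun h => (correct_driver_iff (compliant_echoType Γ) b).1 (h _ (compliant_echoType Γ)),
    fun h _ hR => (correct_driver_iff hR b).2 h⟩

theorem regularRefines_driver_iff (b : List Γ × Option P) :
    RegularRefines (driverType δ b) (echoType Γ .output) ↔
      StateTransition.Reaches (queueStep δ) (b.2, b.1) (none, []) :=
  ⟨fun h => (correct_driver_iff (compliant_echoType Γ) b).1
      (h _ (regular_echoType Γ _) (compliant_echoType Γ)),
    fun h _ _ hR => (correct_driver_iff hR b).2 h⟩

end QueueMachine

open Turing

/-! ### Queue machines simulate machines with several stacks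

The queue holds the symbols of all stacks, tagged with the names of their stacks, the top of each
stack being the last of its symbols. To read a stack, the queue is rotated up to an end marker. -/

section Stacks

variable {K A Λ σ : Type}

/-- The control states that simulate a stack machine: rotating the queue on behalf of the
statement `q`, with the last symbol found on its stack, or clearing the queue. -/
inductive Control (K A Λ σ : Type) : Type
  | scan (q : TM2.Stmt (fun _ : K => A) Λ σ) (v : σ) (held : Option A)
  | clear

/-- What is appended to the queue, and the next control state, when a statement starts. -/
def startStmt : TM2.Stmt (fun _ : K => A) Λ σ → σ →
    List (Option (K × A)) × Option (Control K A Λ σ)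
  | .push k f q, v => (some (k, f v) :: (startStmt q v).1, (startStmt q v).2)
  | .peek k f q, v => ([none], some (.scan (.peek k f q) v none))
  | .pop k f q, v => ([none], some (.scan (.pop k f q) v none))
  | .load a q, v => startStmt q (a v)
  | .branch p q₁ q₂, v => cond (p v) (startStmt q₁ v) (startStmt q₂ v)
  -- A jump reads no stack but still waits for a rotation: the target is not a substatement, so it
  -- cannot be expanded in this structural recursion.
  | .goto l, v => ([none], some (.scan (.goto l) v none))
  | .halt, _ => ([none], some .clear)

/-- The stack that a statement reads. -/
def scannedStack : TM2.Stmt (fun _ : K => A) Λ σ → Option K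
  | .peek k _ _ => some k
  | .pop k _ _ => some k
  | _ => none

/-- What is appended to the queue, and the next control state, when the queue has been rotated on
behalf of a statement. -/
def finishStmt (M : Λ → TM2.Stmt (fun _ : K => A) Λ σ) :
    TM2.Stmt (fun _ : K => A) Λ σ → σ → Option A →
      List (Option (K × A)) × Option (Control K A Λ σ)
  | .peek k f q, v, h =>
      (h.toList.map (fun a => some (k, a)) ++ (startStmt q (f v h)).1, (startStmt q (f v h)).2)
  | .pop _ f q, v, h => startStmt q (f v h)
  | .goto l, v, _ => startStmt (M (l v)) v
  -- Arbitrary value: no rotation is ever started for these statements.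
  | _, _, _ => ([], none)

variable {M : Λ → TM2.Stmt (fun _ : K => A) Λ σ}

/-- The control states that the simulation of a stack machine with support `S` uses. -/
def controls (M : Λ → TM2.Stmt (fun _ : K => A) Λ σ) (S : Finset Λ) : Set (Control K A Λ σ) :=
  insert .clear (⋃ q ∈ {q | ∃ l ∈ S, q ∈ TM2.stmts₁ (M l)},
    Set.range fun x : σ × Option A => .scan q x.1 x.2)

theorem finite_controls [Finite σ] [Finite A] (M : Λ → TM2.Stmt (fun _ : K => A) Λ σ)
    (S : Finset Λ) : (controls M S).Finite := by
  refine Set.Finite.insert _ (Set.Finite.biUnion ?_ fun q _ => Set.finite_range _)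
  have : {q | ∃ l ∈ S, q ∈ TM2.stmts₁ (M l)} = ⋃ l ∈ S, (TM2.stmts₁ (M l) : Set _) := by
    ext q
    simp
  rw [this]
  exact S.finite_toSet.biUnion fun l _ => Finset.finite_toSet _

theorem scan_mem_controls {S : Finset Λ} {q : TM2.Stmt (fun _ : K => A) Λ σ} {v : σ}
    {h : Option A} : .scan q v h ∈ controls M S ↔ ∃ l ∈ S, q ∈ TM2.stmts₁ (M l) := by
  simp [controls]

theorem startStmt_mem_controls {S : Finset Λ} {l : Λ} (hl : l ∈ S)
    (q : TM2.Stmt (fun _ : K => A) Λ σ) : ∀ (v : σ), q ∈ TM2.stmts₁ (M l) →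
      ∀ p ∈ (startStmt q v).2, p ∈ controls M S := by
  induction q with
  | push k f q ih =>
    intro v hq
    exact ih v (TM2.stmts₁_trans hq (by simp [TM2.stmts₁, TM2.stmts₁_self]))
  | peek k f q ih =>
    rintro v hq p ⟨⟩
    exact scan_mem_controls.2 ⟨l, hl, hq⟩
  | pop k f q ih =>
    rintro v hq p ⟨⟩
    exact scan_mem_controls.2 ⟨l, hl, hq⟩
  | load a q ih =>
    intro v hq
    exact ih (a v) (TM2.stmts₁_trans hq (by simp [TM2.stmts₁, TM2.stmts₁_self]))
  | branch f q₁ q₂ ih₁ ih₂ =>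
    intro v hq
    rw [startStmt]
    cases f v
    · exact ih₂ v (TM2.stmts₁_trans hq (by simp [TM2.stmts₁, TM2.stmts₁_self]))
    · exact ih₁ v (TM2.stmts₁_trans hq (by simp [TM2.stmts₁, TM2.stmts₁_self]))
  | goto f =>
    rintro v hq p ⟨⟩
    exact scan_mem_controls.2 ⟨l, hl, hq⟩
  | halt =>
    rintro v hq p ⟨⟩
    exact Or.inl rfl

variable [DecidableEq K]

/-- The transition function of the queue machine that simulates a stack machine. -/
def stackDelta (M : Λ → TM2.Stmt (fun _ : K => A) Λ σ) :
    Control K A Λ σ → Option (K × A) → List (Option (K × A)) × Option (Control K A Λ σ)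
  | .scan q v h, some (k, a) =>
      if scannedStack q = some k then
        -- Symbols of the scanned stack are put back with a delay of one, so that at the marker the
        -- held symbol is the last one, the top.
        (h.toList.map (fun b => some (k, b)), some (.scan q v (some a)))
      else ([some (k, a)], some (.scan q v h))
  | .scan q v h, none => finishStmt M q v h
  -- The stack machine may halt with nonempty stacks, whereas success requires an empty queue.
  | .clear, some _ => ([], some .clear)
  | .clear, none => ([], none)

/-- The symbols of a queue that belong to a stack. -/
def project (k : K) (w : List (K × A)) : List A :=
  w.filterMap fun x => if x.1 = k then some x.2 else none

theorem project_append (k : K) (w w' : List (K × A)) :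
    project k (w ++ w') = project k w ++ project k w' := List.filterMap_append

theorem project_cons_self (k : K) (a : A) (w : List (K × A)) :
    project k ((k, a) :: w) = a :: project k w := by
  simp [project]

theorem project_cons_of_ne {j k : K} (h : k ≠ j) (a : A) (w : List (K × A)) :
    project j ((k, a) :: w) = project j w := by
  simp [project, h]

theorem project_nil (k : K) : project k ([] : List (K × A)) = [] := rfl

/-- Here `w₁` is yet to be scanned and `w₂` has been put back. The delay may change the interleaving
of stacks but not the order within each. The condition on `h` makes an empty hold mean an empty
stack. -/
theorem reaches_scan {q : TM2.Stmt (fun _ : K => A) Λ σ} {k : K} (hq : scannedStack q = some k)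
    (v : σ) (w₁ : List (K × A)) : ∀ (w₂ : List (K × A)) (h : Option A),
      (h = none → project k w₂ = []) → ∃ w h',
        StateTransition.Reaches (queueStep (stackDelta M))
          (some (.scan q v h), w₁.map some ++ none :: w₂.map some)
          (some (.scan q v h'), none :: w.map some) ∧
        (∀ j, j ≠ k → project j w = project j w₂ ++ project j w₁) ∧
        project k w ++ h'.toList = project k w₂ ++ h.toList ++ project k w₁ ∧
        (h' = none → project k w = []) := by
  induction w₁ with
  | nil =>
    intro w₂ h hh
    exact ⟨w₂, h, .refl, by simp [project_nil], by simp [project_nil], hh⟩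
  | cons x w₁ ih =>
    intro w₂ h hh
    obtain ⟨j, a⟩ := x
    by_cases hj : j = k
    · subst hj
      obtain ⟨w, h', hr, h1, h2, h3⟩ := ih (w₂ ++ h.toList.map fun b => (j, b)) (some a)
        (by simp)
      have hproj : project j (h.toList.map fun b => (j, b)) = h.toList := by
        cases h <;> simp [project]
      refine ⟨w, h', .head ?_ hr, ?_, ?_, h3⟩
      · simp [queueStep, stackDelta, hq]
      · intro i hi
        rw [h1 i hi, project_append, project_cons_of_ne hi.symm]
        cases h <;> simp [project, hi.symm]
      · rw [h2, project_append, hproj, project_cons_self]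
        simp
    · obtain ⟨w, h', hr, h1, h2, h3⟩ := ih (w₂ ++ [(j, a)]) h (by
        intro h0
        rw [project_append, hh h0, project_cons_of_ne hj, project_nil, List.nil_append])
      refine ⟨w, h', .head ?_ hr, ?_, ?_, h3⟩
      · simp [queueStep, stackDelta, hq, Ne.symm hj]
      · intro i hi
        rw [h1 i hi, project_append]
        by_cases hi : j = i
        · subst hi
          simp [project_cons_self, project_nil]
        · simp [project_cons_of_ne hi, project_nil]
      · rw [h2, project_append]
        simp [project_cons_of_ne hj, project_nil]

theorem reaches_rotate {q : TM2.Stmt (fun _ : K => A) Λ σ} (hq : scannedStack q = none)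
    (v : σ) (h : Option A) (w₁ : List (K × A)) : ∀ w₂ : List (K × A),
      StateTransition.Reaches (queueStep (stackDelta M))
        (some (.scan q v h), w₁.map some ++ none :: w₂.map some)
        (some (.scan q v h), none :: (w₂ ++ w₁).map some) := by
  induction w₁ with
  | nil =>
    intro w₂
    rw [List.append_nil]
    exact .refl
  | cons x w₁ ih =>
    intro w₂
    obtain ⟨j, a⟩ := x
    have hr := ih (w₂ ++ [(j, a)])
    simp only [List.append_assoc, List.singleton_append, List.map_append, List.map_cons,
      List.map_nil] at hr ⊢
    refine .head ?_ hr
    simp [queueStep, stackDelta, hq]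

theorem reaches_clear (w : List (K × A)) :
    StateTransition.Reaches₁ (queueStep (stackDelta M))
      (some .clear, w.map some ++ [none]) (none, []) := by
  induction w with
  | nil => exact .single (by simp [queueStep, stackDelta])
  | cons x w ih => exact .head (by simp [queueStep, stackDelta]) ih

/-- The queue represents the stacks. -/
def RepresentsStacks (S : K → List A) (w : List (K × A)) : Prop :=
  ∀ k, S k = (project k w).reverse

/-- The queue machine in a configuration has just started a statement. -/
def startConfig (q : TM2.Stmt (fun _ : K => A) Λ σ) (v : σ) (w : List (K × A)) :
    Option (Control K A Λ σ) × List (Option (K × A)) :=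
  ((startStmt q v).2, w.map some ++ (startStmt q v).1)

/-- Configurations of a stack machine and of the queue machine that correspond to each other. -/
def RepresentsCfg (M : Λ → TM2.Stmt (fun _ : K => A) Λ σ) :
    TM2.Cfg (fun _ : K => A) Λ σ → Option (Control K A Λ σ) × List (Option (K × A)) → Prop
  | ⟨some l, v, S⟩, C => ∃ w, RepresentsStacks S w ∧ C = startConfig (M l) v w
  | ⟨none, _, _⟩, C => C = (none, [])

/-- Shared by `pop` and `peek`: the scan removes the top, and `peek` appends it again when it
finishes. -/
theorem exists_reaches_pop {q : TM2.Stmt (fun _ : K => A) Λ σ} {k : K}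
    (hq : scannedStack q = some k) (v : σ) {S : K → List A} {w : List (K × A)}
    (hw : RepresentsStacks S w) : ∃ w',
      StateTransition.Reaches (queueStep (stackDelta M))
        (some (.scan q v none), w.map some ++ [none])
        (some (.scan q v (S k).head?), none :: w'.map some) ∧
      RepresentsStacks (Function.update S k (S k).tail) w' := by
  obtain ⟨w', h', hr, h1, h2, h3⟩ := reaches_scan (M := M) hq v w [] none (fun _ => project_nil k)
  have hk : S k = h'.toList ++ (project k w').reverse := by
    rw [hw k]
    have := congrArg List.reverse h2
    rw [List.reverse_append, project_nil] at this
    simp only [Option.toList_none, List.nil_append] at this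
    rw [← this]
    cases h' <;> rfl
  have hhead : (S k).head? = h' := by
    rw [hk]
    cases h' with
    | none => simp [h3 rfl]
    | some a => rfl
  have htail : (S k).tail = (project k w').reverse := by
    rw [hk]
    cases h' with
    | none => simp [h3 rfl]
    | some a => rfl
  rw [hhead]
  refine ⟨w', hr, fun j => ?_⟩
  by_cases hj : j = k
  · subst hj
    rw [Function.update_self, htail]
  · rw [Function.update_of_ne hj, hw j, h1 j hj, project_nil, List.nil_append]

/-- Induction on the statement. `push`, `load` and `branch` cost no step of their own, but every
statement ends in `goto` or `halt`, which reads the marker; hence at least one step is made. -/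
theorem exists_reaches_stepAux (q : TM2.Stmt (fun _ : K => A) Λ σ) :
    ∀ (v : σ) (S : K → List A) (w : List (K × A)), RepresentsStacks S w →
      ∃ C, RepresentsCfg M (TM2.stepAux q v S) C ∧
        StateTransition.Reaches₁ (queueStep (stackDelta M)) (startConfig q v w) C := by
  induction q with
  | push k f q ih =>
    intro v S w hw
    obtain ⟨C, hC, hr⟩ := ih v (Function.update S k (f v :: S k)) (w ++ [(k, f v)]) (by
      intro j
      by_cases hj : j = k
      · subst hj
        rw [Function.update_self, project_append, project_cons_self, project_nil, hw j]
        simp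
      · rw [Function.update_of_ne hj, project_append, project_cons_of_ne (Ne.symm hj), project_nil,
          List.append_nil, hw j])
    refine ⟨C, hC, ?_⟩
    simpa [startConfig, startStmt] using hr
  | peek k f q ih =>
    intro v S w hw
    obtain ⟨w', hr, hw'⟩ := exists_reaches_pop (M := M) (q := .peek k f q) rfl v hw
    obtain ⟨C, hC, hr'⟩ := ih (f v (S k).head?) S
      (w' ++ (S k).head?.toList.map fun a => (k, a)) (by
        intro j
        rw [project_append, List.reverse_append, ← hw' j]
        by_cases hj : j = k
        · subst hj
          rw [Function.update_self]
          cases S j <;> simp [project]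
        · rw [Function.update_of_ne hj]
          cases S k <;> simp [project, Ne.symm hj])
    refine ⟨C, hC, TransGen.trans_right hr (TransGen.head ?_ hr')⟩
    cases S k <;> simp [queueStep, stackDelta, finishStmt, startConfig]
  | pop k f q ih =>
    intro v S w hw
    obtain ⟨w', hr, hw'⟩ := exists_reaches_pop (M := M) (q := .pop k f q) rfl v hw
    obtain ⟨C, hC, hr'⟩ := ih (f v (S k).head?) _ w' hw'
    refine ⟨C, hC, TransGen.trans_right hr (TransGen.head ?_ hr')⟩
    simp [queueStep, stackDelta, finishStmt, startConfig]
  | load a q ih =>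
    intro v S w hw
    exact ih (a v) S w hw
  | branch p q₁ q₂ ih₁ ih₂ =>
    intro v S w hw
    rw [TM2.stepAux, startConfig, startStmt]
    cases p v
    · exact ih₂ v S w hw
    · exact ih₁ v S w hw
  | goto l =>
    intro v S w hw
    refine ⟨_, ⟨w, hw, rfl⟩, ?_⟩
    refine TransGen.trans_right (reaches_rotate (q := .goto l) rfl v none w []) (.single ?_)
    simp [queueStep, stackDelta, finishStmt, startConfig]
  | halt =>
    intro v S w hw
    exact ⟨_, rfl, reaches_clear w⟩

theorem respects_stackDelta (M : Λ → TM2.Stmt (fun _ : K => A) Λ σ) :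
    StateTransition.Respects (TM2.step M) (queueStep (stackDelta M)) (RepresentsCfg M) := by
  rintro ⟨_ | l, v, S⟩ C hC
  · obtain rfl : C = (none, []) := hC
    rfl
  · obtain ⟨w, hw, rfl⟩ := hC
    exact exists_reaches_stepAux (M l) v S w hw

theorem reaches_halted_iff {c : TM2.Cfg (fun _ : K => A) Λ σ}
    {C : Option (Control K A Λ σ) × List (Option (K × A))} (h : RepresentsCfg M c C) :
    StateTransition.Reaches (queueStep (stackDelta M)) C (none, []) ↔
      (StateTransition.eval (TM2.step M) c).Dom := by
  constructor
  · intro hr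
    rw [← StateTransition.tr_eval_dom (respects_stackDelta M) h]
    exact Part.dom_iff_mem.2 ⟨_, StateTransition.mem_eval.2 ⟨hr, rfl⟩⟩
  · intro hd
    obtain ⟨d, hd⟩ := Part.dom_iff_mem.1 hd
    obtain ⟨D, hD, hr⟩ := StateTransition.tr_eval (respects_stackDelta M) h hd
    rcases d with ⟨_ | l, v, S⟩
    · obtain rfl : D = (none, []) := hD
      exact (StateTransition.mem_eval.1 hr).1
    · cases (StateTransition.mem_eval.1 hd).2

theorem stackDelta_mem_controls {S : Finset Λ} (hS : ∀ l ∈ S, TM2.SupportsStmt S (M l)) :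
    ∀ p ∈ controls M S, ∀ x, ∀ p' ∈ (stackDelta M p x).2, p' ∈ controls M S := by
  rintro (⟨q, v, h⟩ | _) hp (_ | ⟨k, a⟩) p' hp'
  · obtain ⟨l, hl, hq⟩ := scan_mem_controls.1 hp
    cases q with
    | peek k f q =>
      exact startStmt_mem_controls hl q _
        (TM2.stmts₁_trans hq (by simp [TM2.stmts₁, TM2.stmts₁_self])) p' hp'
    | pop k f q =>
      exact startStmt_mem_controls hl q _
        (TM2.stmts₁_trans hq (by simp [TM2.stmts₁, TM2.stmts₁_self])) p' hp'
    | goto f =>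
      have hf := TM2.stmts₁_supportsStmt_mono hq (hS l hl)
      exact startStmt_mem_controls (hf v) _ v TM2.stmts₁_self p' hp'
    | push => cases hp'
    | load => cases hp'
    | branch => cases hp'
    | halt => cases hp'
  · obtain ⟨l, hl, hq⟩ := scan_mem_controls.1 hp
    rw [stackDelta] at hp'
    split_ifs at hp' <;> cases hp' <;> exact scan_mem_controls.2 ⟨l, hl, hq⟩
  · cases hp'
  · cases hp'
    exact Or.inl rfl

end Stacks

/-! ### Computability of the reduction -/

theorem primrec_shiftRhs : Primrec shiftRhs := by
  have hbranch : Primrec fun b : Tag × ℕ => (b.1, b.2 + 1) :=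
    Primrec.pair Primrec.fst (Primrec.succ.comp Primrec.snd)
  have hchoice : Primrec fun r : Polarity × List (Tag × ℕ) =>
      (r.1, r.2.map fun b => (b.1, b.2 + 1)) :=
    Primrec.pair Primrec.fst (Primrec.list_map Primrec.snd (hbranch.comp Primrec.snd).to₂)
  exact Primrec.option_map₁ hchoice

theorem primrec_consSystem : Primrec₂ consSystem := by
  have hhead : Primrec fun a : Tag => (some (.output, [(a, 1)]) : Rhs) :=
    Primrec.option_some.comp (Primrec.pair (Primrec.const _)
      (Primrec.list_cons.comp (Primrec.pair Primrec.id (Primrec.const 1)) (Primrec.const [])))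
  exact Primrec.list_cons.comp (hhead.comp Primrec.fst)
    (Primrec.list_map Primrec.snd (primrec_shiftRhs.comp Primrec.snd).to₂)

section BinaryDigits

open PartrecToTM2

theorem trNat_bit0 {n : ℕ} (hn : n ≠ 0) : trNat (2 * n) = Γ'.bit0 :: trNat n := by
  have h : ((2 * n : ℕ) : Num) = (n : Num).bit0 := by
    rw [← Num.bit0_of_bit0, two_mul, Nat.cast_add]
  rw [trNat, trNat, h]
  cases hp : (n : Num) with
  | zero =>
    refine absurd ?_ hn
    have := congrArg (fun m : Num => (m : ℕ)) hp
    simpa using this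
  | pos p => rfl

theorem trNat_bit1 (n : ℕ) : trNat (2 * n + 1) = Γ'.bit1 :: trNat n := by
  have h : ((2 * n + 1 : ℕ) : Num) = (n : Num).bit1 := by
    rw [← Num.bit1_of_bit1, two_mul, Nat.cast_add, Nat.cast_add, Nat.cast_one]
  rw [trNat, trNat, h]
  cases (n : Num) <;> rfl

theorem trNat_eq {n : ℕ} (hn : n ≠ 0) :
    trNat n = (if n % 2 = 0 then Γ'.bit0 else Γ'.bit1) :: trNat (n / 2) := by
  rcases Nat.even_or_odd' n with ⟨k, rfl | rfl⟩
  · rw [trNat_bit0 (by omega), if_pos (by omega), Nat.mul_div_cancel_left _ two_pos]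
  · rw [trNat_bit1, if_neg (by omega), show (2 * k + 1) / 2 = k by omega]

/-- The digits of `n`, least significant first, are its parity followed by the digits of `n / 2`;
this is a strong recursion. In `hg`, `L` lists the earlier values, so `L.length` is `n`. -/
theorem primrec_map_trNat (τ : Γ' → ℕ) : Primrec fun n => (trNat n).map τ := by
  have hg : Primrec₂ fun (_ : Unit) (L : List (List ℕ)) =>
      if L.length = 0 then some ([] : List ℕ) else
        (L[L.length / 2]?).map fun l =>
          (if L.length % 2 = 0 then τ .bit0 else τ .bit1) :: l := by
    have hlen : Primrec fun x : Unit × List (List ℕ) => x.2.length :=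
      Primrec.list_length.comp Primrec.snd
    have hmod : PrimrecPred fun x : Unit × List (List ℕ) => x.2.length % 2 = 0 :=
      Primrec.eq.comp (Primrec.nat_mod.comp hlen (Primrec.const 2)) (Primrec.const 0)
    refine Primrec.ite (Primrec.eq.comp hlen (Primrec.const 0)) (Primrec.const _) ?_
    refine Primrec.option_map
      (Primrec.list_getElem?.comp Primrec.snd (Primrec.nat_div.comp hlen (Primrec.const 2))) ?_
    exact Primrec.list_cons.comp
      ((Primrec.ite hmod (Primrec.const _) (Primrec.const _)).comp Primrec.fst) Primrec.snd
  have h := Primrec.nat_strong_rec (fun (_ : Unit) n => (trNat n).map τ) hg (by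
    intro _ n
    by_cases hn : n = 0
    · subst hn
      simp
    · have hlt : n / 2 < n := Nat.div_lt_self (Nat.pos_of_ne_zero hn) one_lt_two
      rw [trNat_eq hn]
      simp only [List.length_map, List.length_range, if_neg hn, List.getElem?_map,
        List.getElem?_range hlt, Option.map_some, List.map_cons]
      split_ifs <;> rfl)
  exact h.comp (Primrec.const ()) Primrec.id

theorem primrec_map_reverse_trList (τ : Γ' → ℕ) :
    Primrec fun n => (trList [n]).reverse.map τ := by
  refine (Primrec.list_reverse.comp
    (Primrec.list_append.comp (primrec_map_trNat τ) (Primrec.const [τ .cons]))).of_eq fun n => ?_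
  simp

end BinaryDigits

/-! ### Undecidability -/

/-- The code runs the program numbered `n` on input `0`, so its domain encodes the halting problem.
-/
theorem exists_code_not_computablePred :
    ∃ c : ToPartrec.Code, ¬ ComputablePred fun n : ℕ => (c.eval [n]).Dom := by
  let f : ℕ →. ℕ := fun n => (Denumerable.ofNat Nat.Partrec.Code n).eval 0
  have hf : Partrec f :=
    Nat.Partrec.Code.eval_part.comp (Computable.ofNat _) (Computable.const 0)
  obtain ⟨c, hc⟩ := ToPartrec.Code.exists_code (Nat.Partrec'.part_iff₁.2 hf)
  refine ⟨c, fun ⟨_, h⟩ => ComputablePred.halting_problem 0 ?_⟩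
  have hdom : ∀ n, (c.eval [n]).Dom ↔ (f n).Dom := by
    intro n
    have := hc ⟨[n], rfl⟩
    dsimp only at this
    rw [this]
    rfl
  have hp : ∀ d : Nat.Partrec.Code, (c.eval [Encodable.encode d]).Dom ↔ (d.eval 0).Dom := by
    intro d
    rw [hdom]
    simp only [f, Denumerable.ofNat_encode]
  refine ⟨fun d => decidable_of_iff _ (hp d), (h.comp Computable.encode).of_eq fun d => ?_⟩
  exact decide_eq_decide.2 (hp d)

instance fintypeStackName : Fintype PartrecToTM2.K' :=
  ⟨{.main, .rev, .aux, .stack}, fun k => by cases k <;> simp⟩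

/-- A computable family of pairs of session types for which refinement is undecidable. -/
theorem exists_undecidable_family : ∃ (sys : ℕ → System) (S : ℕ → SessionType) (Q : System)
    (T : SessionType) (p : ℕ → Prop), Computable sys ∧ ¬ ComputablePred p ∧
      (∀ n, Presents (sys n) (S n)) ∧ Presents Q T ∧
      (∀ n, Refines (S n) T ↔ p n) ∧ (∀ n, RegularRefines (S n) T ↔ p n) := by
  obtain ⟨c, hc⟩ := exists_code_not_computablePred
  let Sym := Option (PartrecToTM2.K' × PartrecToTM2.Γ')
  let M : PartrecToTM2.Λ' →
    TM2.Stmt (fun _ : PartrecToTM2.K' => PartrecToTM2.Γ') PartrecToTM2.Λ'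
      (Option PartrecToTM2.Γ') := PartrecToTM2.tr
  let l₀ := PartrecToTM2.trNormal c .halt
  let supp := PartrecToTM2.codeSupp c .halt
  have hsupp : l₀ ∈ supp ∧ ∀ l ∈ supp, TM2.SupportsStmt supp (M l) :=
    PartrecToTM2.tr_supports c .halt
  let b := startStmt (M l₀) none
  -- Initially only the main stack is nonempty; it is reversed because tops come last in the queue.
  let word : ℕ → List (PartrecToTM2.K' × PartrecToTM2.Γ') := fun n =>
    (PartrecToTM2.trList [n]).reverse.map fun a => (.main, a)
  -- `F` is independent of `n`, so its mere existence suffices for computability.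
  obtain ⟨F, hF⟩ := exists_presents_driverType (stackDelta M) (controls M supp)
    (finite_controls M supp) (stackDelta_mem_controls hsupp.2) b
    (startStmt_mem_controls hsupp.1 (M l₀) none TM2.stmts₁_self)
  obtain ⟨Q, hQ⟩ := exists_presents_echoType Sym .output
  have hhalt : ∀ n, StateTransition.Reaches (queueStep (stackDelta M))
      (b.2, (word n).map some ++ b.1) (none, []) ↔ (c.eval [n]).Dom := by
    intro n
    have hrep : RepresentsCfg M (PartrecToTM2.init c [n]) (b.2, (word n).map some ++ b.1) := by
      refine ⟨word n, fun k => ?_, rfl⟩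
      cases k <;> simp [word, project, List.filterMap_map]
    rw [reaches_halted_iff hrep]
    exact (iff_of_eq (congrArg Part.Dom (PartrecToTM2.tr_eval c [n])))
  refine ⟨fun n => (((word n).map some).map tag).foldr consSystem F,
    fun n => driverType (stackDelta M) ((word n).map some ++ b.1, b.2), Q, _,
    fun n => (c.eval [n]).Dom, ?_, hc, ?_, hQ, ?_, ?_⟩
  · have hword : Primrec fun n => ((word n).map some).map tag := by
      refine (primrec_map_reverse_trList fun a => tag (some (.main, a) : Sym)).of_eq fun n => ?_
      simp [word]
    exact (Primrec.list_foldr hword (Primrec.const F)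
      (primrec_consSystem.comp (Primrec.fst.comp Primrec.snd)
        (Primrec.snd.comp Primrec.snd)).to₂).to_comp
  · intro n
    dsimp only
    generalize (word n).map some = w
    induction w with
    | nil => exact hF
    | cons x w ih => exact presents_driverType_cons ih
  · intro n
    rw [refines_driver_iff, hhalt]
  · intro n
    rw [regularRefines_driver_iff, hhalt]

theorem not_decides_of_family {rel : SessionType → SessionType → Prop} {sys : ℕ → System}
    {S : ℕ → SessionType} {Q : System} {T : SessionType} {p : ℕ → Prop} (hsys : Computable sys)
    (hp : ¬ ComputablePred p) (hS : ∀ n, Presents (sys n) (S n)) (hT : Presents Q T)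
    (hrel : ∀ n, rel (S n) T ↔ p n) : ¬ ∃ f : System × System → Bool,
      Computable f ∧ Decides f rel := by
  rintro ⟨f, hf, hdec⟩
  classical
  refine hp ⟨Classical.decPred p, ?_⟩
  refine (hf.comp (hsys.pair (Computable.const Q))).of_eq fun n => ?_
  rw [Bool.eq_iff_iff, hdec _ _ _ _ (hS n) hT, hrel]
  exact (@decide_eq_true_iff (p n) _).symm

end FairAsync

theorem mainTheorem3 :
    (¬ ∃ f : FairAsync.System × FairAsync.System → Bool,
        Computable f ∧ FairAsync.Decides f FairAsync.Refines) ∧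
    (¬ ∃ f : FairAsync.System × FairAsync.System → Bool,
        Computable f ∧ FairAsync.Decides f FairAsync.RegularRefines) := by
  obtain ⟨sys, S, Q, T, p, hsys, hp, hS, hT, h, h'⟩ := FairAsync.exists_undecidable_family
  exact ⟨FairAsync.not_decides_of_family hsys hp hS hT h,
    FairAsync.not_decides_of_family hsys hp hS hT h'⟩
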